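/- Let $G=(V,E)$ be a finite simple graph that is biconnected (connected and without cut vertices). A drawing of $G$ in the plane places the vertices at distinct points and draws each edge as a Jordan arc joining its end-points. Two distinct edges cross if the interiors of their arcs share a point. The drawing is simple if no edge contains a vertex in its interior, edges with a common end-vertex do not cross, no two edges meet tangentially, and any two edges cross at most once. A simple drawing is fan-planar if for every edge $e$ the edges crossing $e$ are all incident to a common vertex on the same side of $e$ (traversed from this vertex, they all pass through $e$ in the same direction). A fan-planar drawing is outer-fan-planar if all vertices lie on the boundary of the outer (unbounded) face, and $G$ is outer-fan-planar if it has an outer-fan-planar drawing. (1) For every circle $\mathcal C$ in the plane, $G$ is outer-fan-planar if and only if $G$ admits an outer-fan-planar drawing in which all edges are straight-line segments and all vertices lie on $\mathcal C$. (2) In every straight-line outer-fan-planar drawing of $G$ with all vertices on a circle, the crossings are determined by the cyclic order of the vertices on the circle. That is, two edges $uv$ and $xy$ cross if and only if their end-points are four distinct vertices that alternate on the circle, i.e. $x$ and $y$ lie in different open arcs of the circle between $u$ and $v$. Moreover, if two such drawings of $G$ (possibly on different circles) have the same counterclockwise cyclic order of the vertices, then the same pairs of edges cross in both, and along each edge,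 traversed from a given end-point, the crossings with other edges occur in the same order. -/

import Mathlib

open Set Filter Topology

/-- A graph is biconnected if it is connected and has no cut vertex. -/
def SimpleGraph.IsBiconnected {V : Type*} (G : SimpleGraph V) : Prop :=
  G.Connected ∧ ∀ v : V, (G.induce ({v}ᶜ : Set V)).Preconnected

/-- A drawing of a graph in the plane `ℂ`: vertices are distinct points and every edge is a curve
between its end-points. The curve of an edge is stored in both directions, one being the reverse of
the other. -/
structure Drawing {V : Type*} (G : SimpleGraph V) where
  pos : V → ℂ
  pos_injective : Function.Injective pos
  curve : ∀ {u v : V}, G.Adj u v → Path (pos u) (pos v)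
  curve_symm : ∀ {u v : V} (h : G.Adj u v), curve h.symm = (curve h).symm

/-- A homeomorphism of the plane that carries the curve `γ` onto the segment from `0` to `1`. For
every Jordan arc there is one (Schoenflies). The two sides of the arc, along its interior, are the
local preimages of the upper and of the lower half-plane. -/
def IsStraightening (h : ℂ ≃ₜ ℂ) {p q : ℂ} (γ : Path p q) : Prop :=
  h '' range γ = segment ℝ (0 : ℂ) 1

/-- Seen through `h`, the curve `δ` passes at time `t` from the upper side of the real axis to the
lower side. -/
def PassesDownward (h : ℂ ≃ₜ ℂ) {p q : ℂ} (δ : Path p q) (t : unitInterval) : Prop :=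
  (∀ᶠ s in 𝓝[<] t, 0 < (h (δ s)).im) ∧ (∀ᶠ s in 𝓝[>] t, (h (δ s)).im < 0)

namespace Drawing

variable {V : Type*} {G : SimpleGraph V}

/-- The curve of an edge without its two end-points. -/
def edgeInterior (D : Drawing G) {u v : V} (e : G.Adj u v) : Set ℂ :=
  D.curve e '' Ioo 0 1

/-- Two (distinct) edges cross if the interiors of their curves share a point. -/
def Crosses (D : Drawing G) {u v x y : V} (e : G.Adj u v) (f : G.Adj x y) : Prop :=
  s(u, v) ≠ s(x, y) ∧ (D.edgeInterior e ∩ D.edgeInterior f).Nonempty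

structure IsSimple (D : Drawing G) : Prop where
  /-- Every edge is a Jordan arc; in particular no edge crosses itself. -/
  curve_injective : ∀ {u v : V} (e : G.Adj u v), Function.Injective (D.curve e)
  /-- No edge contains a vertex in its interior. -/
  vertex_notMem : ∀ {u v : V} (e : G.Adj u v) (w : V), D.pos w ∉ D.edgeInterior e
  /-- No two edges with a common end-vertex cross. -/
  not_crosses_of_incident : ∀ {u v w : V} (e : G.Adj u v) (f : G.Adj u w), ¬ D.Crosses e f
  /-- No two edges cross more than once. -/
  crosses_once : ∀ {u v x y : V} (e : G.Adj u v) (f : G.Adj x y), s(u, v) ≠ s(x, y) →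
    (D.edgeInterior e ∩ D.edgeInterior f).Subsingleton
  /-- No two edges meet tangentially: where `f` meets the interior of `e`, it passes from one side
  of `e` to the other. (Which side is the upper one is immaterial, as `h` may be followed by the
  complex conjugation.) -/
  not_tangent : ∀ {u v x y : V} (e : G.Adj u v) (f : G.Adj x y), s(u, v) ≠ s(x, y) →
    ∀ t ∈ Ioo (0 : unitInterval) 1, D.curve f t ∈ D.edgeInterior e →
      ∃ h : ℂ ≃ₜ ℂ, IsStraightening h (D.curve e) ∧ PassesDownward h (D.curve f) t

/-- A simple drawing is fan-planar if for every edge `e` the edges crossing `e` are all incident to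
a common vertex `z` on the same side of `e`: traversed from `z`, they all pass through `e` from the
same side to the other. -/
structure IsFanPlanar (D : Drawing G) : Prop extends D.IsSimple where
  fan : ∀ {u v : V} (e : G.Adj u v), ∃ (z : V) (h : ℂ ≃ₜ ℂ), IsStraightening h (D.curve e) ∧
    ∀ {x y : V} (f : G.Adj x y), D.Crosses e f →
      ∃ (w : V) (f' : G.Adj z w), s(z, w) = s(x, y) ∧
        ∀ t ∈ Ioo (0 : unitInterval) 1, D.curve f' t ∈ D.edgeInterior e →
          PassesDownward h (D.curve f') t

/-- All points of the plane that are occupied by the drawing. -/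
def support (D : Drawing G) : Set ℂ :=
  range D.pos ∪ {p | ∃ (u v : V) (e : G.Adj u v), p ∈ range (D.curve e)}

/-- The outer face: the unbounded component of the complement of the drawing. -/
def outerFace (D : Drawing G) : Set ℂ :=
  {p | p ∈ D.supportᶜ ∧ ¬ Bornology.IsBounded (connectedComponentIn D.supportᶜ p)}

/-- A fan-planar drawing with all vertices on (the boundary of) the outer face. -/
structure IsOuterFanPlanar (D : Drawing G) : Prop extends D.IsFanPlanar where
  mem_outerFace : ∀ v : V, D.pos v ∈ frontier D.outerFace

/-- Every edge is drawn as the straight-line segment between its end-points. -/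
def IsStraightLine (D : Drawing G) : Prop :=
  ∀ {u v : V} (e : G.Adj u v), range (D.curve e) = segment ℝ (D.pos u) (D.pos v)

/-- All vertices lie on the circle with centre `c` and radius `r`. -/
def IsOnCircle (D : Drawing G) (c : ℂ) (r : ℝ) : Prop :=
  ∀ v : V, D.pos v ∈ Metric.sphere c r

/-- The vertices `u`, `v`, `w` are distinct and appear in this counterclockwise cyclic order around
the centre `c`. -/
def CyclicOrder (D : Drawing G) (c : ℂ) (u v w : V) : Prop :=
  sbtw ((D.pos u - c).arg : Real.Angle) ((D.pos v - c).arg : Real.Angle)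
    ((D.pos w - c).arg : Real.Angle)

/-- Along the edge `e`, traversed from `u` to `v`, a crossing with `f` comes strictly before a
crossing with `g`. -/
def CrossesBefore (D : Drawing G) {u v x y x' y' : V} (e : G.Adj u v) (f : G.Adj x y)
    (g : G.Adj x' y') : Prop :=
  D.Crosses e f ∧ D.Crosses e g ∧ ∃ s ∈ Ioo (0 : unitInterval) 1, ∃ t ∈ Ioo (0 : unitInterval) 1,
    s < t ∧ D.curve e s ∈ D.edgeInterior f ∧ D.curve e t ∈ D.edgeInterior g

end Drawing

/-- A graph is outer-fan-planar if it admits an outer-fan-planar drawing. -/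
def SimpleGraph.IsOuterFanPlanar {V : Type*} (G : SimpleGraph V) : Prop :=
  ∃ D : Drawing G, D.IsOuterFanPlanar

/-!
The edges of a straight-line drawing with all vertices on a circle are chords, and two chords cross
if and only if their end-points alternate (`openSegment_inter_iff`). As three points of a circle are
in counterclockwise order if and only if their triangle is positively oriented
(`sbtw_arg_iff_orient_pos`), the signs of `orient` translate between cyclic orders and crossings.
Two different edges crossing `uv` in a fan-planar drawing are of the form `zw` and `zw'`, and the
order in which they cross `uv` is the order in which they leave `z`, hence again a matter of
orientations of triangles (`Drawing.crossesBefore_iff_orient`).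

The substance is that an arbitrary outer-fan-planar drawing can be made straight on a circle. It
suffices to find distinct points on a circle, one for each vertex, such that chords representing
edges cross only if the edges cross in the given drawing (`Drawing.exists_circle_model`). Then the
edges crossing a given one still have a common vertex `z`, and chords from `z` all pass through a
given chord from the side of `z` (`Drawing.isOuterFanPlanar_straightLine`).

The points on the circle come from a homeomorphism of the plane that is the identity on the drawing
and pulls, for every vertex, a nearby point of the outer face out of a large disc. It exists since
the outer face is open and connected (`IsPreconnected.exists_homeomorph_forall_mem`). Its effect is
that every vertex is joined to a point of the boundary circle by a short path whose image lies in
the disc. Two edges whose points alternate on the circle yield two paths in a disc with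
alternating end-points, and such paths meet (`Path.exists_eq_of_inscribed_quadrilateral`): otherwise
the difference of the two paths would be a map from the square to the punctured plane whose
argument increases along all four sides of the square. So neither the Jordan curve theorem nor the
existence of straightenings for general arcs is needed.
-/

/-! ### Orientation of triangles, and chords of a circle -/

/-- Twice the signed area of the triangle `a b c`: it is positive if and only if `a`, `b`, `c` are
the corners of a triangle in counterclockwise order. -/
def orient (a b c : ℂ) : ℝ :=
  (b.re - a.re) * (c.im - a.im) - (b.im - a.im) * (c.re - a.re)

theorem orient_swap (a b c : ℂ) : orient a c b = -orient a b c := by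
  simp only [orient]; ring

theorem orient_rotate (a b c : ℂ) : orient b c a = orient a b c := by
  simp only [orient]; ring

/-- For representatives in `(-π, π]`, the cyclic order of angles is that of real numbers: an even
permutation of `a < b < c`. -/
theorem sbtw_coe_angle_iff {a b c : ℝ} (ha : a ∈ Ioc (-Real.pi) Real.pi)
    (hb : b ∈ Ioc (-Real.pi) Real.pi) (hc : c ∈ Ioc (-Real.pi) Real.pi) :
    sbtw (a : Real.Angle) (b : Real.Angle) (c : Real.Angle) ↔
      0 < (b - a) * (c - b) * (c - a) := by
  have hp : Fact ((0 : ℝ) < 2 * Real.pi) := ⟨by simp [Real.pi_pos]⟩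
  have h1 : sbtw (a : Real.Angle) (b : Real.Angle) (c : Real.Angle) ↔
      toIocMod hp.out c a < toIcoMod hp.out c b := by
    rw [sbtw_iff_not_btw, ← not_le]
    exact not_congr QuotientAddGroup.btw_coe_iff
  have h2 : toIocMod hp.out c a = if c < a then a else a + 2 * Real.pi := by
    rw [toIocMod_eq_iff]
    split_ifs with h
    · exact ⟨⟨h, by linarith [ha.2, hc.1]⟩, 0, by simp⟩
    · exact ⟨⟨by linarith [ha.1, hc.2], by linarith⟩, -1, by simp⟩
  have h3 : toIcoMod hp.out c b = if c ≤ b then b else b + 2 * Real.pi := by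
    rw [toIcoMod_eq_iff]
    split_ifs with h
    · exact ⟨⟨h, by linarith [hb.2, hc.1]⟩, 0, by simp⟩
    · exact ⟨⟨by linarith [hb.1, hc.2], by linarith⟩, -1, by simp⟩
  rw [h1, h2, h3]
  simp only [mul_pos_iff, mul_neg_iff, sub_pos, sub_neg]
  obtain ⟨ha1, ha2⟩ := ha
  obtain ⟨hb1, hb2⟩ := hb
  obtain ⟨hc1, hc2⟩ := hc
  split_ifs <;> grind

/-- For points of a circle the signed area is a product of half-angle sines, so that its sign can be
read off from differences of arguments. -/
theorem orient_polar (o : ℂ) (r x y z : ℝ) :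
    orient (o + r * Complex.exp (x * Complex.I)) (o + r * Complex.exp (y * Complex.I))
      (o + r * Complex.exp (z * Complex.I)) =
      4 * r ^ 2 * (Real.sin ((y - x) / 2) * Real.sin ((z - y) / 2) * Real.sin ((z - x) / 2)) := by
  have key : ∀ p q : ℝ, Real.sin (2 * p) + Real.sin (2 * q) - Real.sin (2 * (p + q)) =
      4 * (Real.sin p * Real.sin q * Real.sin (p + q)) := by
    intro p q
    simp only [Real.sin_two_mul, Real.sin_add, Real.cos_add]
    have h1 := Real.sin_sq_add_cos_sq p
    have h2 := Real.sin_sq_add_cos_sq q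
    have h1' : Real.cos p ^ 2 = 1 - Real.sin p ^ 2 := by linarith
    have h2' : Real.cos q ^ 2 = 1 - Real.sin q ^ 2 := by linarith
    ring_nf
    simp only [h1', h2']
    ring
  have := key ((y - x) / 2) ((z - y) / 2)
  rw [show (y - x) / 2 + (z - y) / 2 = (z - x) / 2 by ring] at this
  rw [mul_right_comm, ← this]
  simp only [orient, Complex.add_re, Complex.add_im, Complex.re_ofReal_mul,
    Complex.im_ofReal_mul, Complex.exp_ofReal_mul_I_re, Complex.exp_ofReal_mul_I_im]
  rw [show 2 * ((y - x) / 2) = y - x by ring, show 2 * ((z - y) / 2) = z - y by ring,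
    show 2 * ((z - x) / 2) = z - x by ring, Real.sin_sub, Real.sin_sub, Real.sin_sub]
  ring

/-- On a circle, the cyclic order of three points is the orientation of their triangle. -/
theorem sbtw_arg_iff_orient_pos {o : ℂ} {r : ℝ} (hr : 0 < r) {a b c : ℂ}
    (ha : a ∈ Metric.sphere o r) (hb : b ∈ Metric.sphere o r) (hc : c ∈ Metric.sphere o r) :
    sbtw ((a - o).arg : Real.Angle) ((b - o).arg : Real.Angle) ((c - o).arg : Real.Angle) ↔
      0 < orient a b c := by
  have hpolar : ∀ z ∈ Metric.sphere o r,
      z = o + r * Complex.exp ((z - o).arg * Complex.I) := by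
    intro z hz
    rw [mem_sphere_iff_norm] at hz
    have := Complex.norm_mul_exp_arg_mul_I (z - o)
    rw [hz] at this
    rw [this]; ring
  have hsign : ∀ z w : ℂ, 0 < Real.sin ((w.arg - z.arg) / 2) ↔ 0 < w.arg - z.arg := by
    intro z w
    have h1 := Complex.arg_mem_Ioc z
    have h2 := Complex.arg_mem_Ioc w
    constructor
    · intro h
      by_contra! h3
      have := Real.sin_nonpos_of_nonpos_of_neg_pi_le (x := (w.arg - z.arg) / 2) (by linarith)
        (by linarith [h1.2, h2.1])
      linarith
    · intro h
      exact Real.sin_pos_of_pos_of_lt_pi (by linarith) (by linarith [h1.1, h2.2])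
  rw [sbtw_coe_angle_iff (Complex.arg_mem_Ioc _) (Complex.arg_mem_Ioc _) (Complex.arg_mem_Ioc _)]
  conv_rhs => rw [hpolar a ha, hpolar b hb, hpolar c hc, orient_polar]
  rw [mul_pos_iff_of_pos_left (show 0 < 4 * r ^ 2 by positivity)]
  have hneg : ∀ z w : ℂ, Real.sin ((w.arg - z.arg) / 2) < 0 ↔ w.arg - z.arg < 0 := by
    intro z w
    rw [← neg_pos, ← Real.sin_neg, ← neg_div, neg_sub, hsign, ← neg_pos, neg_sub]
  simp only [mul_pos_iff, mul_neg_iff, hsign, hneg]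

theorem exists_lineMap_of_mem_openSegment {a b p : ℂ} (h : p ∈ openSegment ℝ a b) :
    ∃ s ∈ Ioo (0 : ℝ) 1, p = AffineMap.lineMap a b s := by
  rw [openSegment_eq_image_lineMap] at h
  obtain ⟨s, hs, rfl⟩ := h
  exact ⟨s, hs, rfl⟩

theorem lineMap_re (a b : ℂ) (s : ℝ) :
    (AffineMap.lineMap a b s : ℂ).re = a.re + s * (b.re - a.re) := by
  simp [AffineMap.lineMap_apply]; ring

theorem lineMap_im (a b : ℂ) (s : ℝ) :
    (AffineMap.lineMap a b s : ℂ).im = a.im + s * (b.im - a.im) := by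
  simp [AffineMap.lineMap_apply]; ring

theorem orient_lineMap (a b c d : ℂ) (s : ℝ) :
    orient a b (AffineMap.lineMap c d s) = (1 - s) * orient a b c + s * orient a b d := by
  simp only [orient, lineMap_re, lineMap_im]; ring

/-- Along a chord the squared distance to the centre is `r²` minus a multiple of `s (1 - s)`. -/
theorem normSq_lineMap_sub {o : ℂ} {r : ℝ} {a b : ℂ} (ha : a ∈ Metric.sphere o r)
    (hb : b ∈ Metric.sphere o r) (s : ℝ) :
    Complex.normSq (AffineMap.lineMap a b s - o) =
      r ^ 2 - s * (1 - s) * Complex.normSq (b - a) := by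
  have h : ∀ z ∈ Metric.sphere o r, Complex.normSq (z - o) = r ^ 2 := by
    intro z hz
    rw [Complex.normSq_eq_norm_sq, mem_sphere_iff_norm.1 hz]
  have h1 := h a ha
  have h2 := h b hb
  simp only [Complex.normSq_apply, Complex.sub_re, Complex.sub_im, lineMap_re, lineMap_im] at *
  linear_combination (1 - s) * h1 + s * h2

theorem exists_lineMap_of_orient_eq_zero {a b x : ℂ} (hab : a ≠ b) (h : orient a b x = 0) :
    ∃ s : ℝ, x = AffineMap.lineMap a b s := by
  have hn : Complex.normSq (b - a) ≠ 0 := by simpa [sub_eq_zero] using hab.symm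
  simp only [orient, Complex.normSq_apply, Complex.sub_re, Complex.sub_im] at *
  -- the foot of the perpendicular from `x` is `x` itself
  refine ⟨((b.re - a.re) * (x.re - a.re) + (b.im - a.im) * (x.im - a.im)) /
    ((b.re - a.re) * (b.re - a.re) + (b.im - a.im) * (b.im - a.im)), ?_⟩
  apply Complex.ext
  · rw [lineMap_re, div_mul_eq_mul_div, ← sub_eq_iff_eq_add', eq_div_iff hn]
    linear_combination -(b.im - a.im) * h
  · rw [lineMap_im, div_mul_eq_mul_div, ← sub_eq_iff_eq_add', eq_div_iff hn]
    linear_combination (b.re - a.re) * h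

/-- A line meets a circle in at most two points. -/
theorem eq_or_eq_of_orient_eq_zero {o : ℂ} {r : ℝ} {a b x : ℂ} (ha : a ∈ Metric.sphere o r)
    (hb : b ∈ Metric.sphere o r) (hx : x ∈ Metric.sphere o r) (hab : a ≠ b)
    (h : orient a b x = 0) : x = a ∨ x = b := by
  obtain ⟨s, rfl⟩ := exists_lineMap_of_orient_eq_zero hab h
  have h1 := normSq_lineMap_sub ha hb s
  rw [Complex.normSq_eq_norm_sq, mem_sphere_iff_norm.1 hx] at h1
  have hn : Complex.normSq (b - a) ≠ 0 := by simpa [sub_eq_zero] using hab.symm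
  have h2 : s * (1 - s) = 0 := by
    have : s * (1 - s) * Complex.normSq (b - a) = 0 := by linarith
    simpa [hn] using this
  rcases mul_eq_zero.1 h2 with h3 | h3
  · left; simp [h3]
  · right; simp [show s = 1 by linarith]

/-- Two different chords of a circle that share an interior point have their end-points strictly
on opposite sides of each other. -/
theorem orient_mul_neg_of_openSegment_inter {o : ℂ} {r : ℝ} {a b x y : ℂ}
    (ha : a ∈ Metric.sphere o r) (hb : b ∈ Metric.sphere o r)
    (hx : x ∈ Metric.sphere o r) (hy : y ∈ Metric.sphere o r) (hab : a ≠ b) (hxy : x ≠ y)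
    (hne : s(a, b) ≠ s(x, y)) (h : (openSegment ℝ a b ∩ openSegment ℝ x y).Nonempty) :
    orient a b x * orient a b y < 0 := by
  obtain ⟨p, hp, hp'⟩ := h
  obtain ⟨s, -, rfl⟩ := exists_lineMap_of_mem_openSegment hp
  obtain ⟨t, ht, hst⟩ := exists_lineMap_of_mem_openSegment hp'
  have h1 : orient a b (AffineMap.lineMap a b s) = 0 := by
    simp only [orient, lineMap_re, lineMap_im]; ring
  rw [hst, orient_lineMap] at h1
  have hx0 : orient a b x ≠ 0 := by
    intro h0
    have hy0 : orient a b y = 0 := by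
      rw [h0] at h1
      simpa [ht.1.ne'] using h1
    rcases eq_or_eq_of_orient_eq_zero ha hb hx hab h0 with rfl | rfl <;>
      rcases eq_or_eq_of_orient_eq_zero ha hb hy hab hy0 with rfl | rfl
    · exact hxy rfl
    · exact hne rfl
    · exact hne Sym2.eq_swap
    · exact hxy rfl
  have h2 : 0 < (1 - t) * (orient a b x) ^ 2 :=
    mul_pos (by linarith [ht.2]) (by positivity)
  have h3 : t * (orient a b x * orient a b y) < 0 := by
    linear_combination h2 + orient a b x * h1
  by_contra! h4
  have := mul_nonneg ht.1.le h4
  linarith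

/-- If the end-points of a chord of a circle lie on opposite sides of another one, then the two
chords share an interior point. -/
theorem openSegment_inter_of_orient_mul_neg {o : ℂ} {r : ℝ} {a b x y : ℂ}
    (ha : a ∈ Metric.sphere o r) (hb : b ∈ Metric.sphere o r)
    (hx : x ∈ Metric.sphere o r) (hy : y ∈ Metric.sphere o r)
    (h : orient a b x * orient a b y < 0) :
    (openSegment ℝ a b ∩ openSegment ℝ x y).Nonempty := by
  have hab : a ≠ b := by
    rintro rfl
    simp [orient] at h
  have hxy : x ≠ y := by
    rintro rfl
    nlinarith [mul_self_nonneg (orient a b x)]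
  -- the parameter at which the side changes along the second chord
  obtain ⟨t, ht, ht0⟩ : ∃ t ∈ Ioo (0 : ℝ) 1,
      (1 - t) * orient a b x + t * orient a b y = 0 := by
    have hd : orient a b x - orient a b y ≠ 0 := by
      intro h0
      rw [sub_eq_zero.1 h0] at h
      nlinarith [mul_self_nonneg (orient a b y)]
    refine ⟨orient a b x / (orient a b x - orient a b y), ?_, by field_simp; ring⟩
    rcases mul_neg_iff.1 h with ⟨h1, h2⟩ | ⟨h1, h2⟩
    · exact ⟨div_pos h1 (by linarith), (div_lt_one (by linarith)).2 (by linarith)⟩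
    · exact ⟨div_pos_of_neg_of_neg h1 (by linarith), by
        rw [div_lt_one_of_neg (by linarith)]; linarith⟩
  rw [← orient_lineMap] at ht0
  obtain ⟨s, hs⟩ := exists_lineMap_of_orient_eq_zero hab ht0
  refine ⟨AffineMap.lineMap x y t, ?_, ?_⟩
  · have h1 := normSq_lineMap_sub ha hb s
    rw [← hs, normSq_lineMap_sub hx hy t] at h1
    have h2 : 0 < Complex.normSq (b - a) := Complex.normSq_pos.2 (sub_ne_zero.2 hab.symm)
    have h3 : 0 < Complex.normSq (y - x) := Complex.normSq_pos.2 (sub_ne_zero.2 hxy.symm)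
    have h4 : 0 < s * (1 - s) * Complex.normSq (b - a) := by
      have : 0 < t * (1 - t) * Complex.normSq (y - x) :=
        mul_pos (mul_pos ht.1 (by linarith [ht.2])) h3
      linarith
    have h5 : 0 < s * (1 - s) := pos_of_mul_pos_left h4 h2.le
    rw [hs, openSegment_eq_image_lineMap]
    refine ⟨s, ⟨?_, ?_⟩, rfl⟩ <;> nlinarith
  · rw [openSegment_eq_image_lineMap]
    exact ⟨t, ht, rfl⟩

theorem openSegment_inter_iff {o : ℂ} {r : ℝ} {a b x y : ℂ}
    (ha : a ∈ Metric.sphere o r) (hb : b ∈ Metric.sphere o r)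
    (hx : x ∈ Metric.sphere o r) (hy : y ∈ Metric.sphere o r) (hab : a ≠ b) (hxy : x ≠ y) :
    s(a, b) ≠ s(x, y) ∧ (openSegment ℝ a b ∩ openSegment ℝ x y).Nonempty ↔
      orient a b x * orient a b y < 0 := by
  refine ⟨fun h => orient_mul_neg_of_openSegment_inter ha hb hx hy hab hxy h.1 h.2,
    fun h => ⟨?_, openSegment_inter_of_orient_mul_neg ha hb hx hy h⟩⟩
  intro he
  rcases Sym2.eq_iff.1 he with ⟨rfl, rfl⟩ | ⟨rfl, rfl⟩ <;> simp [orient] at h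

/-! ### Paths in a disc with alternating end-points -/

open scoped ComplexConjugate in
/-- If a curve stays in an open half-plane bounded by a line through `0` and ends to the left of the
ray through its initial point, then a continuous argument increases from the beginning to the
end. -/
theorem im_lt_im_of_exp_mem_halfPlane {l : ℝ → ℂ} (hl : Continuous l) (w : ℂ)
    (hw : ∀ s ∈ Icc (0 : ℝ) 1, 0 < (conj w * Complex.exp (l s)).re)
    (h : 0 < (conj (Complex.exp (l 0)) * Complex.exp (l 1)).im) : (l 0).im < (l 1).im := by
  have hw0 : conj w ≠ 0 := by
    intro h0
    have := hw 0 (by simp)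
    simp [h0] at this
  set m := Complex.log (conj w) with hm
  have hm' : Complex.exp m = conj w := Complex.exp_log hw0
  have hcos : ∀ s ∈ Icc (0 : ℝ) 1, 0 < Real.cos ((l s).im + m.im) := by
    intro s hs
    have := hw s hs
    rw [← hm', ← Complex.exp_add, Complex.exp_re] at this
    have h2 := pos_of_mul_pos_right this (Real.exp_pos _).le
    rwa [Complex.add_im, add_comm] at h2
  have hc : ContinuousOn (fun s => (l s).im) (Icc 0 1) := by fun_prop
  have hsin : 0 < Real.sin ((l 1).im - (l 0).im) := by
    rw [← Complex.exp_conj, ← Complex.exp_add, Complex.exp_im] at h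
    have h2 := pos_of_mul_pos_right h (Real.exp_pos _).le
    rwa [Complex.add_im, Complex.conj_im, neg_add_eq_sub] at h2
  by_contra! hle
  have hlt : (l 1).im ≤ (l 0).im - Real.pi := by
    by_contra! h2
    have := Real.sin_nonpos_of_nonpos_of_neg_pi_le (x := (l 1).im - (l 0).im) (by linarith)
      (by linarith)
    linarith
  -- The argument would drop by `π`, hence pass from the half-plane to the opposite one.
  obtain ⟨s, hs, hs'⟩ := intermediate_value_Icc' zero_le_one hc
    (show (l 0).im - Real.pi ∈ Icc (l 1).im (l 0).im from ⟨hlt, by linarith [Real.pi_pos]⟩)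
  have h1 := hcos s hs
  have h0 := hcos 0 (by simp)
  simp only at hs'
  rw [hs', show (l 0).im - Real.pi + m.im = (l 0).im + m.im - Real.pi by ring,
    Real.cos_sub_pi] at h1
  linarith

open scoped ComplexConjugate in
/-- Seen from a point `w` of a circle, the rest of the closed disc lies in an open half-plane. -/
theorem re_conj_mul_sub_pos {R : ℝ} {w z : ℂ} (hw : ‖w‖ = R) (hz : ‖z‖ ≤ R) (h : z ≠ w) :
    0 < (conj w * (w - z)).re := by
  have h1 : 0 < Complex.normSq (w - z) := Complex.normSq_pos.2 (sub_ne_zero.2 h.symm)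
  have h2 : Complex.normSq w = R ^ 2 := by rw [Complex.normSq_eq_norm_sq, hw]
  have h3 : Complex.normSq z ≤ R ^ 2 := by
    rw [Complex.normSq_eq_norm_sq]
    exact pow_le_pow_left₀ (norm_nonneg _) hz 2
  simp only [Complex.normSq_apply, Complex.sub_re, Complex.sub_im, Complex.mul_re,
    Complex.conj_re, Complex.conj_im] at *
  nlinarith

open scoped ComplexConjugate in
/-- If all four interior angles of the quadrilateral `a₀ b₀ a₁ b₁` inscribed in a circle are
positive, then a path in the disc from `a₀` to `a₁` meets every path in the disc from `b₀` to
`b₁`. Otherwise `(s, t) ↦ α s - β t` has a continuous argument on the unit square; on every side of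
the square this map stays in a half-plane, since one of the points is a fixed point of the
circle, so that the argument increases along all four sides. -/
theorem Path.exists_eq_of_inscribed_quadrilateral {R : ℝ} {a₀ a₁ b₀ b₁ : ℂ}
    (ha₀ : ‖a₀‖ = R) (ha₁ : ‖a₁‖ = R) (hb₀ : ‖b₀‖ = R) (hb₁ : ‖b₁‖ = R)
    (α : Path a₀ a₁) (β : Path b₀ b₁) (hα : ∀ s, ‖α s‖ ≤ R) (hβ : ∀ s, ‖β s‖ ≤ R)
    (h₁ : 0 < (conj (a₀ - b₀) * (a₁ - b₀)).im) (h₂ : 0 < (conj (a₁ - b₀) * (a₁ - b₁)).im)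
    (h₃ : 0 < (conj (a₁ - b₁) * (a₀ - b₁)).im) (h₄ : 0 < (conj (a₀ - b₁) * (a₀ - b₀)).im) :
    ∃ s t, α s = β t := by
  by_contra! hne
  have hα' : ∀ s, ‖α.extend s‖ ≤ R := fun s => hα _
  have hβ' : ∀ s, ‖β.extend s‖ ≤ R := fun s => hβ _
  have hne' : ∀ s t, α.extend s ≠ β.extend t := fun s t => hne _ _
  obtain ⟨L, -, hL⟩ := (Complex.isCoveringMapOn_exp.existsUnique_continuousMap_lifts
    (A := ℝ × ℝ) ⟨fun p => α.extend p.1 - β.extend p.2, by fun_prop⟩ (a₀ := (0, 0))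
    (Complex.exp_log (x := α.extend 0 - β.extend 0) (sub_ne_zero.2 (hne' _ _)))
    (fun p => sub_ne_zero.2 (hne' _ _))).exists
  have hexp : ∀ s t, Complex.exp (L (s, t)) = α.extend s - β.extend t :=
    fun s t => congrFun hL (s, t)
  have hLc : Continuous L := L.continuous
  have e₁ := im_lt_im_of_exp_mem_halfPlane (l := fun s => L (s, 0)) (by fun_prop) (-b₀)
    (by
      intro s _
      have := re_conj_mul_sub_pos hb₀ (hα' s) (by simpa using hne' s 0)
      simp only [hexp, Path.extend_zero]
      rw [map_neg, neg_mul, ← mul_neg, neg_sub]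
      exact this) (by simpa [hexp] using h₁)
  have e₂ := im_lt_im_of_exp_mem_halfPlane (l := fun s => L (1, s)) (by fun_prop) a₁
    (by
      intro s _
      have := re_conj_mul_sub_pos ha₁ (hβ' s) (by simpa using (hne' 1 s).symm)
      simpa only [hexp, Path.extend_one] using this) (by simpa [hexp] using h₂)
  have e₃ := im_lt_im_of_exp_mem_halfPlane (l := fun s => L (1 - s, 1)) (by fun_prop) (-b₁)
    (by
      intro s _
      have := re_conj_mul_sub_pos hb₁ (hα' (1 - s)) (by simpa using hne' (1 - s) 1)
      simp only [hexp, Path.extend_one]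
      rw [map_neg, neg_mul, ← mul_neg, neg_sub]
      exact this) (by simpa [hexp] using h₃)
  have e₄ := im_lt_im_of_exp_mem_halfPlane (l := fun s => L (0, 1 - s)) (by fun_prop) a₀
    (by
      intro s _
      have := re_conj_mul_sub_pos ha₀ (hβ' (1 - s)) (by simpa using (hne' 0 (1 - s)).symm)
      simpa only [hexp, Path.extend_zero] using this) (by simpa [hexp] using h₄)
  simp only [sub_zero, sub_self] at e₃ e₄
  linarith

/-- In a disc, two paths joining the end-points of two crossing chords meet. -/
theorem Path.exists_eq_of_crossing_chords {R : ℝ} {a b x y : ℂ}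
    (ha : a ∈ Metric.sphere 0 R) (hb : b ∈ Metric.sphere 0 R) (hx : x ∈ Metric.sphere 0 R)
    (hy : y ∈ Metric.sphere 0 R) (h : orient a b x * orient a b y < 0)
    (α : Path a b) (β : Path x y) (hα : ∀ s, α s ∈ Metric.closedBall 0 R)
    (hβ : ∀ s, β s ∈ Metric.closedBall 0 R) : ∃ s t, α s = β t := by
  wlog hpos : 0 < orient a b x generalizing x y
  · have hpos' : 0 < orient a b y := by
      by_contra! h0
      have := mul_nonneg_of_nonpos_of_nonpos (not_lt.1 hpos) h0
      linarith
    obtain ⟨s, t, hst⟩ := this hy hx (by rwa [mul_comm]) β.symm (fun s => hβ _) hpos'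
    exact ⟨s, unitInterval.symm t, hst⟩
  have hneg : orient a b y < 0 := by
    by_contra! h0
    have := mul_nonneg hpos.le h0
    linarith
  have hab : a ≠ b := by
    rintro rfl
    simp [orient] at h
  have hxy : x ≠ y := by
    rintro rfl
    linarith
  have hne : s(x, y) ≠ s(a, b) ∧ (openSegment ℝ x y ∩ openSegment ℝ a b).Nonempty := by
    rw [ne_comm, inter_comm]
    exact (openSegment_inter_iff ha hb hx hy hab hxy).2 h
  have h' := (openSegment_inter_iff hx hy ha hb hxy hab).1 hne
  -- both sides are twice the signed area of the quadrilateral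
  have harea : orient x y b - orient x y a = orient a b x - orient a b y := by
    simp only [orient]; ring
  have hb' : 0 < orient x y b := by
    by_contra! h0
    have := mul_nonneg_of_nonpos_of_nonpos (show orient x y a ≤ 0 by linarith) h0
    linarith
  have ha' : orient x y a < 0 := by
    by_contra! h0
    have := mul_nonneg h0 hb'.le
    linarith
  simp only [mem_sphere_zero_iff_norm, mem_closedBall_zero_iff] at *
  apply Path.exists_eq_of_inscribed_quadrilateral ha hb hx hy α β hα hβ <;>
    simp only [orient, Complex.mul_im, Complex.conj_re, Complex.conj_im, Complex.sub_re,
      Complex.sub_im] at * <;> linarith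

/-! ### Homeomorphisms moving points within a connected open set of the plane -/

/-- A homeomorphism that moves the centre of a disc to another point of the disc and fixes
everything outside of the disc: the translation by `b - a`, damped linearly to the identity, is a
contractive perturbation of the identity. -/
theorem exists_homeomorph_of_mem_ball {a b : ℂ} {r : ℝ} (hb : b ∈ Metric.ball a r) :
    ∃ φ : ℂ ≃ₜ ℂ, φ a = b ∧ ∀ z ∉ Metric.ball a r, φ z = z := by
  have hr : 0 < r := Metric.pos_of_mem_ball hb
  rw [mem_ball_iff_norm] at hb
  let f : ℂ → ℂ := fun z => z + (max (1 - ‖z - a‖ / r) 0 : ℝ) • (b - a)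
  have hf : ApproximatesLinearOn f ((ContinuousLinearEquiv.refl ℝ ℂ : ℂ ≃L[ℝ] ℂ) : ℂ →L[ℝ] ℂ)
      univ (‖b - a‖₊ / r.toNNReal) := by
    intro z _ w _
    have h1 : f z - f w - ((ContinuousLinearEquiv.refl ℝ ℂ : ℂ ≃L[ℝ] ℂ) : ℂ →L[ℝ] ℂ) (z - w) =
        (max (1 - ‖z - a‖ / r) 0 - max (1 - ‖w - a‖ / r) 0 : ℝ) • (b - a) := by
      simp only [f, sub_smul, ContinuousLinearEquiv.coe_coe, ContinuousLinearEquiv.refl_apply]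
      ring
    have h2 : |max (1 - ‖z - a‖ / r) 0 - max (1 - ‖w - a‖ / r) 0| ≤ ‖z - w‖ / r := by
      refine (abs_max_sub_max_le_abs _ _ _).trans ?_
      rw [show (1 - ‖z - a‖ / r) - (1 - ‖w - a‖ / r) = (‖w - a‖ - ‖z - a‖) / r by ring, abs_div,
        abs_of_pos hr]
      gcongr
      refine (abs_norm_sub_norm_le _ _).trans_eq ?_
      rw [sub_sub_sub_cancel_right, norm_sub_rev]
    rw [h1, norm_smul, Real.norm_eq_abs]
    push_cast
    rw [Real.coe_toNNReal _ hr.le]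
    calc _ ≤ ‖z - w‖ / r * ‖b - a‖ := by gcongr
      _ = _ := by ring
  have hc : ‖b - a‖₊ / r.toNNReal <
      ‖((ContinuousLinearEquiv.refl ℝ ℂ).symm : ℂ →L[ℝ] ℂ)‖₊⁻¹ := by
    have : ((ContinuousLinearEquiv.refl ℝ ℂ).symm : ℂ →L[ℝ] ℂ) = ContinuousLinearMap.id ℝ ℂ := rfl
    rw [this, ← NNReal.coe_lt_coe]
    simp [hr.le, div_lt_one hr, hb]
  refine ⟨hf.toHomeomorph f (Or.inr hc), ?_, fun z hz => ?_⟩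
  · change f a = b
    simp [f]
  · change f z = z
    rw [mem_ball_iff_norm, not_lt] at hz
    have : 1 - ‖z - a‖ / r ≤ 0 := by
      rw [sub_nonpos, one_le_div hr]
      exact hz
    simp [f, max_eq_right this]

/-- Connected open subsets of the plane are homogeneous. -/
theorem IsPreconnected.exists_homeomorph {U : Set ℂ} (hU : IsPreconnected U) (hUo : IsOpen U)
    {a b : ℂ} (ha : a ∈ U) (hb : b ∈ U) :
    ∃ φ : ℂ ≃ₜ ℂ, φ a = b ∧ ∀ z ∉ U, φ z = z := by
  refine hU.induction₂ (fun a b => ∃ φ : ℂ ≃ₜ ℂ, φ a = b ∧ ∀ z ∉ U, φ z = z) ?_ ?_ ?_ ha hb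
  · intro x hx
    obtain ⟨r, hr, hrU⟩ := Metric.isOpen_iff.1 hUo x hx
    filter_upwards [mem_nhdsWithin_of_mem_nhds (Metric.ball_mem_nhds x hr)] with y hy
    obtain ⟨φ, h1, h2⟩ := exists_homeomorph_of_mem_ball hy
    exact ⟨φ, h1, fun z hz => h2 z fun h => hz (hrU h)⟩
  · rintro x y z - - - ⟨φ, rfl, h2⟩ ⟨χ, rfl, h4⟩
    exact ⟨φ.trans χ, rfl, fun w hw => by simp [h2 w hw, h4 w hw]⟩
  · rintro x y - - ⟨φ, rfl, h2⟩
    refine ⟨φ.symm, by simp, fun w hw => ?_⟩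
    rw [Homeomorph.symm_apply_eq, h2 w hw]

theorem isPreconnected_setOf_norm_sub_mem {I : Set ℝ} (hI : IsPreconnected I) (hI0 : I ⊆ Ici 0)
    (c : ℂ) : IsPreconnected {z : ℂ | ‖z - c‖ ∈ I} := by
  have h : {z : ℂ | ‖z - c‖ ∈ I} =
      (fun p : ℝ × ℝ => c + p.1 * Complex.exp (p.2 * Complex.I)) '' (I ×ˢ univ) := by
    ext z
    constructor
    · intro hz
      refine ⟨(‖z - c‖, (z - c).arg), ⟨hz, trivial⟩, ?_⟩
      simp [Complex.norm_mul_exp_arg_mul_I]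
    · rintro ⟨⟨ρ, θ⟩, ⟨h1, -⟩, rfl⟩
      have : 0 ≤ ρ := hI0 h1
      simpa [abs_of_nonneg this] using h1
  rw [h]
  exact (hI.prod isPreconnected_univ).image _ (by fun_prop)

theorem IsPreconnected.diff_singleton {U : Set ℂ} (hU : IsPreconnected U) (hUo : IsOpen U)
    (c : ℂ) : IsPreconnected (U \ {c}) := by
  by_cases hc : c ∈ U
  swap
  · rwa [sdiff_singleton_eq_self hc]
  obtain ⟨r, hr, hrU⟩ := Metric.isOpen_iff.1 hUo c hc
  have hB : IsPreconnected (Metric.ball c r \ {c}) := by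
    convert isPreconnected_setOf_norm_sub_mem (isPreconnected_Ioo (a := 0) (b := r))
      (fun x hx => hx.1.le) c using 1
    ext z
    simp [dist_eq_norm, sub_eq_zero, and_comm]
  have hVo : IsOpen (U \ {c}) := hUo.sdiff isClosed_singleton
  -- A part of `U \ {c}` containing the punctured disc stays open when the disc is filled in.
  have key : ∀ u v : Set ℂ, IsOpen u → IsOpen v → U \ {c} ⊆ u ∪ v → (U \ {c}) ∩ (u ∩ v) = ∅ →
      Metric.ball c r \ {c} ⊆ u → U \ {c} ⊆ u := by
    intro u v hu hv huv hdis hBu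
    have hdis' : ∀ z ∈ U \ {c}, z ∈ u → z ∉ v := fun z hz h1 h2 =>
      (hdis.subset ⟨hz, h1, h2⟩ : z ∈ (∅ : Set ℂ))
    have hcov : U ⊆ ((u ∩ (U \ {c})) ∪ Metric.ball c r) ∪ v ∩ (U \ {c}) := by
      intro z hz
      by_cases hzc : z = c
      · subst hzc
        exact Or.inl (Or.inr (Metric.mem_ball_self hr))
      · rcases huv ⟨hz, hzc⟩ with h | h
        · exact Or.inl (Or.inl ⟨h, hz, hzc⟩)
        · exact Or.inr ⟨h, hz, hzc⟩
    have hemp : U ∩ (((u ∩ (U \ {c})) ∪ Metric.ball c r) ∩ (v ∩ (U \ {c}))) = ∅ := by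
      rw [eq_empty_iff_forall_notMem]
      rintro z ⟨-, h1 | h1, h2⟩
      · exact hdis' z h2.2 h1.1 h2.1
      · exact hdis' z h2.2 (hBu ⟨h1, h2.2.2⟩) h2.1
    rcases isPreconnected_iff_subset_of_disjoint.1 hU _ _ ((hu.inter hVo).union Metric.isOpen_ball)
      (hv.inter hVo) hcov hemp with h | h
    · intro z hz
      rcases h hz.1 with h1 | h1
      · exact h1.1
      · exact hBu ⟨h1, hz.2⟩
    · exact absurd rfl (h hc).2.2
  rw [isPreconnected_iff_subset_of_disjoint]
  intro u v hu hv huv hdis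
  have hBU : Metric.ball c r \ {c} ⊆ U \ {c} := sdiff_subset_sdiff_left hrU
  rcases isPreconnected_iff_subset_of_disjoint.1 hB u v hu hv (hBU.trans huv)
    (subset_empty_iff.1 ((inter_subset_inter_left _ hBU).trans hdis.subset)) with h | h
  · exact Or.inl (key u v hu hv huv hdis h)
  · exact Or.inr (key v u hv hu (by rwa [union_comm]) (by rwa [inter_comm v u]) h)

theorem IsPreconnected.diff_finite {U F : Set ℂ} (hU : IsPreconnected U) (hUo : IsOpen U)
    (hF : F.Finite) : IsPreconnected (U \ F) := by
  induction F, hF using Set.Finite.induction_on with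
  | empty => simpa
  | @insert a F _ hF ih =>
    rw [← union_singleton, ← sdiff_sdiff]
    exact ih.diff_singleton (hUo.sdiff hF.isClosed) a

/-- Finitely many points of a connected open set `U` can be moved simultaneously into any infinite
subset of `U`, by a homeomorphism of the plane that is the identity outside of `U`: move one point
after the other, within the complement of the points that have been moved before. -/
theorem IsPreconnected.exists_homeomorph_forall_mem {ι : Type*} [Finite ι] {U E : Set ℂ}
    (hU : IsPreconnected U) (hUo : IsOpen U) (hE : E.Infinite) (hEU : E ⊆ U) {c : ι → ℂ}
    (hc : Function.Injective c) (hcU : ∀ i, c i ∈ U) :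
    ∃ φ : ℂ ≃ₜ ℂ, (∀ z ∉ U, φ z = z) ∧ ∀ i, φ (c i) ∈ E := by
  classical
  have := Fintype.ofFinite ι
  suffices h : ∀ s : Finset ι, ∃ φ : ℂ ≃ₜ ℂ, (∀ z ∉ U, φ z = z) ∧ ∀ i ∈ s, φ (c i) ∈ E by
    simpa using h Finset.univ
  intro s
  induction s using Finset.induction_on with
  | empty => exact ⟨Homeomorph.refl ℂ, by simp, by simp⟩
  | insert i s his ih =>
    obtain ⟨φ, hφ, hφE⟩ := ih
    have hF : ((fun j => φ (c j)) '' (s : Set ι)).Finite := s.finite_toSet.image _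
    set F := (fun j => φ (c j)) '' (s : Set ι) with hF_def
    obtain ⟨e, heE, heF⟩ := (hE.sdiff hF).nonempty
    have hi : φ (c i) ∈ U \ F := by
      constructor
      · by_contra h
        exact h ((φ.injective (hφ _ h)).symm ▸ hcU i)
      · rintro ⟨j, hj, hji⟩
        exact his (hc (φ.injective hji) ▸ hj)
    obtain ⟨χ, hχ, hχU⟩ := (hU.diff_finite hUo hF).exists_homeomorph (hUo.sdiff hF.isClosed) hi
      (show e ∈ U \ F from ⟨hEU heE, heF⟩)
    refine ⟨φ.trans χ, fun z hz => ?_, fun j hj => ?_⟩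
    · rw [Homeomorph.trans_apply, hφ z hz, hχU z fun h => hz h.1]
    · rw [Homeomorph.trans_apply]
      rcases Finset.mem_insert.1 hj with rfl | hj
      · rwa [hχ]
      · rw [hχU _ fun h => h.2 ⟨j, hj, rfl⟩]
        exact hφE j hj

/-! ### From an outer drawing to points on a circle -/

theorem not_isBounded_compl_closedBall (c : ℂ) (r : ℝ) :
    ¬ Bornology.IsBounded (Metric.closedBall c r)ᶜ := by
  intro h
  have := (Metric.isBounded_closedBall (x := c) (r := r)).union h
  rw [union_compl_self] at this
  exact NormedSpace.unbounded_univ ℝ ℂ this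

theorem isPreconnected_compl_closedBall (c : ℂ) {r : ℝ} (hr : 0 ≤ r) :
    IsPreconnected (Metric.closedBall c r)ᶜ := by
  convert isPreconnected_setOf_norm_sub_mem (isPreconnected_Ioi (a := r))
    (fun x hx => hr.trans (le_of_lt hx)) c using 1
  ext z
  simp [dist_eq_norm]

/-- A function on `[0, 1]` that falls from at least `R` to at most `R` does so for a last time. -/
theorem exists_last_eq {h : ℝ → ℝ} (hc : Continuous h) {R : ℝ} (h0 : R ≤ h 0) (h1 : h 1 ≤ R) :
    ∃ t ∈ Icc (0 : ℝ) 1, h t = R ∧ ∀ s ∈ Icc t 1, h s ≤ R := by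
  have hS : IsCompact (Icc (0 : ℝ) 1 ∩ h ⁻¹' Ici R) :=
    isCompact_Icc.inter_right (isClosed_Ici.preimage hc)
  obtain ⟨t, ⟨ht, htR⟩, hmax⟩ := hS.exists_isGreatest ⟨0, by simp, h0⟩
  obtain ⟨s, hs, hsR⟩ := intermediate_value_Icc' ht.2 hc.continuousOn (show R ∈ Icc (h 1) (h t) from
    ⟨h1, htR⟩)
  have hst : s = t := le_antisymm (hmax ⟨⟨ht.1.trans hs.1, hs.2⟩, hsR.ge⟩) hs.1
  have htR' : h t = R := hst ▸ hsR
  refine ⟨t, ht, htR', fun s hs => ?_⟩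
  by_contra! h2
  have hst' : s ≤ t := hmax ⟨⟨ht.1.trans hs.1, hs.2⟩, h2.le⟩
  rw [le_antisymm hst' hs.1, htR'] at h2
  exact lt_irrefl _ h2

theorem eventually_disjoint_ball {p : ℂ} {C : Set ℂ} (hC : IsClosed C) (hp : p ∉ C) :
    ∀ᶠ ε in 𝓝[>] (0 : ℝ), Disjoint (Metric.ball p ε) C := by
  obtain ⟨δ, hδ, hδC⟩ := Metric.isOpen_iff.1 hC.isOpen_compl p hp
  filter_upwards [Ioo_mem_nhdsGT hδ] with ε hε
  exact disjoint_left.2 fun z hz => hδC (Metric.ball_subset_ball hε.2.le hz)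

theorem eventually_disjoint_balls {p q : ℂ} (hpq : p ≠ q) :
    ∀ᶠ ε in 𝓝[>] (0 : ℝ), Disjoint (Metric.ball p ε) (Metric.ball q ε) := by
  filter_upwards [Ioo_mem_nhdsGT (half_pos (dist_pos.2 hpq))] with ε hε
  exact Metric.ball_disjoint_ball (by linarith [hε.2])

namespace Drawing

variable {V : Type*} {G : SimpleGraph V}

theorem isCompact_support [Finite V] (D : Drawing G) : IsCompact D.support := by
  have h : {p | ∃ (u v : V) (e : G.Adj u v), p ∈ range (D.curve e)} =
      ⋃ (u : V) (v : V) (e : G.Adj u v), range (D.curve e) := by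
    ext p
    simp
  rw [support, h]
  refine (finite_range _).isCompact.union ?_
  exact isCompact_iUnion fun u => isCompact_iUnion fun v => isCompact_iUnion fun e =>
    isCompact_range (D.curve e).continuous

theorem range_curve_subset_support (D : Drawing G) {u v : V} (e : G.Adj u v) :
    range (D.curve e) ⊆ D.support :=
  fun _ hp => Or.inr ⟨u, v, e, hp⟩

theorem pos_mem_support (D : Drawing G) (v : V) : D.pos v ∈ D.support :=
  Or.inl ⟨v, rfl⟩

theorem compl_closedBall_subset_outerFace (D : Drawing G) {c : ℂ} {r : ℝ} (hr : 0 ≤ r)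
    (h : D.support ⊆ Metric.closedBall c r) : (Metric.closedBall c r)ᶜ ⊆ D.outerFace := by
  intro z hz
  have hsub := compl_subset_compl.2 h
  refine ⟨hsub hz, fun hb => not_isBounded_compl_closedBall c r (hb.subset ?_)⟩
  exact (isPreconnected_compl_closedBall c hr).subset_connectedComponentIn hz hsub

/-- There is only one unbounded component of the complement of a bounded drawing. -/
theorem exists_outerFace_eq_connectedComponentIn (D : Drawing G) {c : ℂ} {r : ℝ} (hr : 0 ≤ r)
    (h : D.support ⊆ Metric.closedBall c r) :
    ∃ w, D.outerFace = connectedComponentIn D.supportᶜ w := by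
  have hsub := compl_subset_compl.2 h
  obtain ⟨w, hw⟩ : (Metric.closedBall c r)ᶜ.Nonempty := by
    by_contra h0
    rw [not_nonempty_iff_eq_empty] at h0
    exact not_isBounded_compl_closedBall c r (h0 ▸ Bornology.isBounded_empty)
  refine ⟨w, Subset.antisymm ?_ ?_⟩
  · rintro p ⟨hp, hpb⟩
    obtain ⟨q, hq, hqr⟩ : ∃ q ∈ connectedComponentIn D.supportᶜ p, q ∉ Metric.closedBall c r := by
      by_contra! h0
      exact hpb (Metric.isBounded_closedBall.subset h0)
    have hqw := (isPreconnected_compl_closedBall c hr).subset_connectedComponentIn hw hsub hqr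
    rw [connectedComponentIn_eq hqw, ← connectedComponentIn_eq hq]
    exact mem_connectedComponentIn hp
  · intro p hp
    have := D.compl_closedBall_subset_outerFace hr h hw
    refine ⟨connectedComponentIn_subset _ _ hp, ?_⟩
    rw [← connectedComponentIn_eq hp]
    exact this.2

theorem mem_edgeInterior (D : Drawing G) {u v : V} (e : G.Adj u v) {p : ℂ}
    (hp : p ∈ range (D.curve e)) (hu : p ≠ D.pos u) (hv : p ≠ D.pos v) : p ∈ D.edgeInterior e := by
  obtain ⟨t, rfl⟩ := hp
  refine ⟨t, ⟨?_, ?_⟩, rfl⟩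
  · refine lt_of_le_of_ne unitInterval.nonneg' ?_
    rintro rfl
    exact hu (D.curve e).source
  · refine lt_of_le_of_ne unitInterval.le_one' ?_
    rintro rfl
    exact hv (D.curve e).target

/-- Discs around the vertices that are disjoint from each other and from all non-incident edges. -/
theorem exists_radius (D : Drawing G) [Finite V]
    (hD : ∀ {u v : V} (e : G.Adj u v) (w : V), D.pos w ∉ D.edgeInterior e) :
    ∃ ε : ℝ, 0 < ε ∧
      (∀ u v, u ≠ v → Disjoint (Metric.ball (D.pos u) ε) (Metric.ball (D.pos v) ε)) ∧
      ∀ w x y (f : G.Adj x y), w ≠ x → w ≠ y →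
        Disjoint (Metric.ball (D.pos w) ε) (range (D.curve f)) := by
  have h1 : ∀ᶠ ε in 𝓝[>] (0 : ℝ), ∀ u v, u ≠ v →
      Disjoint (Metric.ball (D.pos u) ε) (Metric.ball (D.pos v) ε) := by
    simp only [eventually_all]
    exact fun u v huv => eventually_disjoint_balls (D.pos_injective.ne huv)
  have h2 : ∀ᶠ ε in 𝓝[>] (0 : ℝ), ∀ w x y (f : G.Adj x y), w ≠ x → w ≠ y →
      Disjoint (Metric.ball (D.pos w) ε) (range (D.curve f)) := by
    simp only [eventually_all]
    intro w x y f hwx hwy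
    refine eventually_disjoint_ball (isCompact_range (D.curve f).continuous).isClosed fun hw => ?_
    exact hD f w (D.mem_edgeInterior f hw (D.pos_injective.ne hwx) (D.pos_injective.ne hwy))
  obtain ⟨ε, ⟨h1, h2⟩, hε⟩ := ((h1.and h2).and self_mem_nhdsWithin).exists
  exact ⟨ε, hε, h1, h2⟩

/-- If all vertices lie on the boundary of the outer face, then there are distinct points on a
circle, one for each vertex, such that edges cross in the given drawing whenever the corresponding
chords of the circle cross.

The homeomorphism `ψ` of the plane fixes the drawing and moves, for every vertex `w`, a point of
the outer face near `w` out of a disc containing the drawing. So close to `w` there is a path `A w`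
from `w` to a point `p w` with `ψ (p w)` on the boundary of the disc, and `ψ` carries `A w` into the
disc. If the chords from `ψ (p u)` to `ψ (p v)` and from `ψ (p x)` to `ψ (p y)` cross, then the
images of the path composed of `A u`, the edge `uv` and `A v` and of the corresponding path for the
edge `xy` have to meet in the disc. As the `A w` are close to the vertices, only the two edges
themselves can do that. -/
theorem exists_circle_model [Finite V] (D : Drawing G)
    (hD : ∀ {u v : V} (e : G.Adj u v) (w : V), D.pos w ∉ D.edgeInterior e)
    (hout : ∀ v, D.pos v ∈ frontier D.outerFace) :
    ∃ R : ℝ, 0 < R ∧ ∃ q : V → ℂ, Function.Injective q ∧ (∀ v, q v ∈ Metric.sphere 0 R) ∧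
      ∀ {u v x y : V} (e : G.Adj u v) (f : G.Adj x y),
        orient (q u) (q v) (q x) * orient (q u) (q v) (q y) < 0 → D.Crosses e f := by
  obtain ⟨R, hR, hKR⟩ := D.isCompact_support.isBounded.subset_ball_lt 0 0
  have hKR' : D.support ⊆ Metric.closedBall 0 R := hKR.trans Metric.ball_subset_closedBall
  obtain ⟨ε, hε, hballs, hedges⟩ := D.exists_radius hD
  obtain ⟨w₀, hw₀⟩ := D.exists_outerFace_eq_connectedComponentIn hR.le hKR'
  have hUo : IsOpen D.outerFace := by
    rw [hw₀]
    exact D.isCompact_support.isClosed.isOpen_compl.connectedComponentIn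
  have hUc : IsPreconnected D.outerFace := by
    rw [hw₀]
    exact isPreconnected_connectedComponentIn
  have hc : ∀ v, ∃ c ∈ D.outerFace, c ∈ Metric.ball (D.pos v) ε := by
    intro v
    obtain ⟨c, hc, hc'⟩ := Metric.mem_closure_iff.1 (frontier_subset_closure (hout v)) ε hε
    exact ⟨c, hc, by rwa [Metric.mem_ball, dist_comm]⟩
  choose c hcU hcε using hc
  have inj_of_ball : ∀ c : V → ℂ, (∀ v, c v ∈ Metric.ball (D.pos v) ε) → Function.Injective c := by
    intro c hc u v huv
    by_contra hne
    exact disjoint_left.1 (hballs u v hne) (hc u) (huv ▸ hc v)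
  obtain ⟨ψ, hψ, hψc⟩ := hUc.exists_homeomorph_forall_mem hUo
    (fun hfin => not_isBounded_compl_closedBall 0 R hfin.isBounded)
    (D.compl_closedBall_subset_outerFace hR.le hKR') (inj_of_ball c hcε) hcU
  have hψK : ∀ z ∈ D.support, ψ z = z := fun z hz => hψ z fun h => h.1 hz
  have hp : ∀ v, ∃ p, ψ p ∈ Metric.sphere 0 R ∧ p ∈ Metric.ball (D.pos v) ε ∧
      JoinedIn (ψ ⁻¹' Metric.closedBall 0 R ∩ Metric.ball (D.pos v) ε) p (D.pos v) := by
    intro v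
    have hseg : ∀ s ∈ Icc (0 : ℝ) 1,
        AffineMap.lineMap (c v) (D.pos v) s ∈ Metric.ball (D.pos v) ε := fun s hs =>
      (convex_ball _ _).lineMap_mem (hcε v) (Metric.mem_ball_self hε) hs
    have h0 := hψc v
    have h1 := hKR' (D.pos_mem_support v)
    rw [← hψK _ (D.pos_mem_support v)] at h1
    simp only [mem_compl_iff, mem_closedBall_zero_iff, not_le] at h0 h1
    obtain ⟨t, ht, htR, hts⟩ := exists_last_eq
      (h := fun s => ‖ψ (AffineMap.lineMap (c v) (D.pos v) s)‖) (R := R)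
      (ψ.continuous.comp AffineMap.lineMap_continuous).norm (by simpa using h0.le)
      (by simpa using h1)
    refine ⟨AffineMap.lineMap (c v) (D.pos v) t, by simpa using htR, hseg t ht, ?_⟩
    refine JoinedIn.ofLine
      (f := fun s => AffineMap.lineMap (c v) (D.pos v) (AffineMap.lineMap t 1 s : ℝ)) ?_ ?_ ?_ ?_
    · exact (AffineMap.lineMap_continuous.comp AffineMap.lineMap_continuous).continuousOn
    · simp
    · simp
    · rintro - ⟨s, hs, rfl⟩
      have hs' : (AffineMap.lineMap t 1 s : ℝ) ∈ Icc t 1 :=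
        (convex_Icc t 1).lineMap_mem (left_mem_Icc.2 ht.2) (right_mem_Icc.2 ht.2) hs
      exact ⟨by simpa using hts _ hs', hseg _ ⟨ht.1.trans hs'.1, hs'.2⟩⟩
  choose p hpR hpε hpj using hp
  refine ⟨R, hR, fun v => ψ (p v), ψ.injective.comp (inj_of_ball p hpε), hpR, ?_⟩
  have hpath : ∀ {u v : V} (e : G.Adj u v), JoinedIn (ψ ⁻¹' Metric.closedBall 0 R ∩
      (Metric.ball (D.pos u) ε ∪ Metric.ball (D.pos v) ε ∪ range (D.curve e))) (p u) (p v) := by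
    intro u v e
    have he : JoinedIn (ψ ⁻¹' Metric.closedBall 0 R ∩
        (Metric.ball (D.pos u) ε ∪ Metric.ball (D.pos v) ε ∪ range (D.curve e)))
        (D.pos u) (D.pos v) := by
      refine ⟨D.curve e, fun t => ⟨?_, Or.inr ⟨t, rfl⟩⟩⟩
      have ht := D.range_curve_subset_support e ⟨t, rfl⟩
      rw [mem_preimage, hψK _ ht]
      exact hKR' ht
    refine ((hpj u).mono ?_).trans (he.trans ((hpj v).mono ?_).symm)
    · exact inter_subset_inter_right _ fun z hz => Or.inl (Or.inl hz)
    · exact inter_subset_inter_right _ fun z hz => Or.inl (Or.inr hz)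
  intro u v x y e f h
  have hux : u ≠ x := by rintro rfl; simp [orient] at h
  have huy : u ≠ y := by rintro rfl; simp [orient] at h
  have hvx : v ≠ x := by rintro rfl; simp [orient, mul_comm] at h
  have hvy : v ≠ y := by rintro rfl; simp [orient, mul_comm] at h
  obtain ⟨γ, hγ⟩ := hpath e
  obtain ⟨δ, hδ⟩ := hpath f
  obtain ⟨s, t, hst⟩ := Path.exists_eq_of_crossing_chords (hpR u) (hpR v) (hpR x) (hpR y) h
    (γ.map ψ.continuous) (δ.map ψ.continuous) (fun s => (hγ s).1) (fun s => (hδ s).1)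
  have hst' : γ s = δ t := ψ.injective hst
  have h1 := (hγ s).2
  have h2 := (hδ t).2
  rw [← hst'] at h2
  have hcontra : ∀ {A B : Set ℂ}, Disjoint A B → γ s ∈ A → γ s ∈ B → D.Crosses e f :=
    fun hAB hA hB => absurd hB (disjoint_left.1 hAB hA)
  rcases h1 with (h1 | h1) | h1 <;> rcases h2 with (h2 | h2) | h2
  · exact hcontra (hballs _ _ hux) h1 h2
  · exact hcontra (hballs _ _ huy) h1 h2
  · exact hcontra (hedges _ _ _ f hux huy) h1 h2
  · exact hcontra (hballs _ _ hvx) h1 h2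
  · exact hcontra (hballs _ _ hvy) h1 h2
  · exact hcontra (hedges _ _ _ f hvx hvy) h1 h2
  · exact hcontra (hedges _ _ _ e hux.symm hvx.symm) h2 h1
  · exact hcontra (hedges _ _ _ e huy.symm hvy.symm) h2 h1
  · refine ⟨fun hs => ?_, γ s, D.mem_edgeInterior e h1 ?_ ?_, D.mem_edgeInterior f h2 ?_ ?_⟩
    · rcases Sym2.eq_iff.1 hs with ⟨h, -⟩ | ⟨h, -⟩
      exacts [hux h, huy h]
    · intro h
      exact disjoint_left.1 (hedges u x y f hux huy) (Metric.mem_ball_self hε) (h ▸ h2)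
    · intro h
      exact disjoint_left.1 (hedges v x y f hvx hvy) (Metric.mem_ball_self hε) (h ▸ h2)
    · intro h
      exact disjoint_left.1 (hedges x u v e hux.symm hvx.symm) (Metric.mem_ball_self hε) (h ▸ h1)
    · intro h
      exact disjoint_left.1 (hedges y u v e huy.symm hvy.symm) (Metric.mem_ball_self hε) (h ▸ h1)

end Drawing

/-! ### Straight-line drawings -/

/-- For a segment there is a straightening that carries the side of a given point to the upper
half-plane. -/
theorem exists_isStraightening_of_range_eq_segment {a b : ℂ} (hab : a ≠ b) (γ : Path a b)
    (hγ : range γ = segment ℝ a b) {z₀ : ℂ} (hz₀ : orient a b z₀ ≠ 0) :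
    ∃ h : ℂ ≃ₜ ℂ, IsStraightening h γ ∧ ∀ z, (0 < (h z).im ↔ 0 < orient a b z₀ * orient a b z) ∧
      ((h z).im < 0 ↔ orient a b z₀ * orient a b z < 0) := by
  have hba : b - a ≠ 0 := sub_ne_zero.2 hab.symm
  have hn : 0 < Complex.normSq (b - a) := Complex.normSq_pos.2 hba
  let g : ℂ ≃ₜ ℂ := (Homeomorph.subRight a).trans (Homeomorph.mulRight₀ (b - a)⁻¹ (inv_ne_zero hba))
  have hg : ∀ z, g z = (z - a) * (b - a)⁻¹ := fun z => rfl
  have hgs : ∀ s : ℝ, g (AffineMap.lineMap a b s) = s := by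
    intro s
    rw [hg, AffineMap.lineMap_apply_module', add_sub_cancel_right, Complex.real_smul,
      mul_inv_cancel_right₀ hba]
  have hgim : ∀ z, (g z).im = orient a b z / Complex.normSq (b - a) := by
    intro z
    rw [hg, Complex.inv_def, ← mul_assoc, Complex.im_mul_ofReal, div_eq_mul_inv]
    congr 1
    simp only [Complex.mul_im, Complex.sub_re, Complex.sub_im, Complex.conj_re, Complex.conj_im,
      orient]
    ring
  have hseg : ∀ k : ℂ ≃ₜ ℂ, (∀ s : ℝ, k (AffineMap.lineMap a b s) = s) → IsStraightening k γ := by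
    intro k hk
    rw [IsStraightening, hγ, segment_eq_image_lineMap, segment_eq_image_lineMap, image_image]
    refine image_congr fun s _ => ?_
    rw [hk, AffineMap.lineMap_apply_module']
    simp
  rcases hz₀.lt_or_gt with h | h
  · refine ⟨g.trans Complex.conjCLE.toHomeomorph, hseg _ fun s => ?_, fun z => ?_⟩
    · simp [hgs]
    · have : ((g.trans Complex.conjCLE.toHomeomorph) z).im =
          -(orient a b z / Complex.normSq (b - a)) := by
        simp [hgim]
      rw [this, neg_pos, neg_lt_zero, div_lt_iff₀ hn, zero_mul, div_pos_iff_of_pos_right hn]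
      simp [mul_pos_iff, mul_neg_iff, h, h.not_gt]
  · refine ⟨g, hseg _ hgs, fun z => ?_⟩
    rw [hgim, div_lt_iff₀ hn, zero_mul, div_pos_iff_of_pos_right hn]
    simp [mul_neg_iff, h, h.not_gt]

theorem exists_orient_ne_zero {a b : ℂ} (hab : a ≠ b) : ∃ z, orient a b z ≠ 0 := by
  refine ⟨a + Complex.I * (b - a), ?_⟩
  have hn : Complex.normSq (b - a) ≠ 0 := by simpa [sub_eq_zero] using hab.symm
  convert hn using 1
  simp only [orient, Complex.normSq_apply, Complex.add_re, Complex.add_im, Complex.mul_re,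
    Complex.mul_im, Complex.I_re, Complex.I_im, Complex.sub_re, Complex.sub_im]
  ring

/-- A Jordan arc that covers a segment runs through it monotonically. -/
theorem Path.exists_strictMono_of_range_subset_segment {a b : ℂ} (hab : a ≠ b) (γ : Path a b)
    (hinj : Function.Injective γ) (hγ : range γ ⊆ segment ℝ a b) :
    ∃ l : unitInterval → ℝ, StrictMono l ∧ ∀ s, γ s = AffineMap.lineMap a b (l s) := by
  have hba : b - a ≠ 0 := sub_ne_zero.2 hab.symm
  let l : unitInterval → ℝ := fun s => ((γ s - a) * (b - a)⁻¹).re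
  have hl : ∀ s, γ s = AffineMap.lineMap a b (l s) := by
    intro s
    have hs := hγ ⟨s, rfl⟩
    rw [segment_eq_image_lineMap] at hs
    obtain ⟨t, -, ht⟩ := hs
    have : l s = t := by
      simp only [l]
      rw [← ht, AffineMap.lineMap_apply_module', add_sub_cancel_right, Complex.real_smul,
        mul_inv_cancel_right₀ hba, Complex.ofReal_re]
    rw [this, ht]
  refine ⟨l, Continuous.strictMono_of_inj_boundedOrder (by fun_prop) ?_ ?_, hl⟩
  · have h0 : l ⊥ = 0 := by
      change ((γ 0 - a) * (b - a)⁻¹).re = 0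
      simp
    have h1 : l ⊤ = 1 := by
      change ((γ 1 - a) * (b - a)⁻¹).re = 1
      simp [hba]
    rw [h0, h1]
    exact zero_le_one
  · intro s t hst
    apply hinj
    rw [hl s, hl t, hst]

namespace Drawing

variable {V : Type*} {G : SimpleGraph V}

theorem edgeInterior_eq_of_sym2_eq (D : Drawing G) {u v x y : V} (e : G.Adj u v) (f : G.Adj x y)
    (h : s(u, v) = s(x, y)) : D.edgeInterior e = D.edgeInterior f := by
  rcases Sym2.eq_iff.1 h with ⟨rfl, rfl⟩ | ⟨rfl, rfl⟩
  · rfl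
  · have hsub : ∀ {a b : V} (k : G.Adj a b), D.edgeInterior k ⊆ D.edgeInterior k.symm := by
      rintro a b k - ⟨t, ht, rfl⟩
      refine ⟨unitInterval.symm t, ⟨?_, ?_⟩, ?_⟩
      · simpa using unitInterval.symm_lt_symm.2 ht.2
      · simpa using unitInterval.symm_lt_symm.2 ht.1
      · rw [D.curve_symm k]
        simp
    exact (hsub e).antisymm (hsub f)

theorem pos_ne (D : Drawing G) {u v : V} (e : G.Adj u v) : D.pos u ≠ D.pos v :=
  D.pos_injective.ne e.ne

theorem edgeInterior_eq_openSegment (D : Drawing G) (hs : D.IsStraightLine) {u v : V}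
    (e : G.Adj u v) (he : Function.Injective (D.curve e)) :
    D.edgeInterior e = openSegment ℝ (D.pos u) (D.pos v) := by
  ext p
  constructor
  · rintro ⟨t, ht, rfl⟩
    refine mem_openSegment_of_ne_left_right ?_ ?_ (hs e ▸ mem_range_self t)
    · intro h
      exact ht.1.ne (he ((D.curve e).source.trans h))
    · intro h
      exact ht.2.ne' (he ((D.curve e).target.trans h))
  · intro hp
    have hpr : p ∈ range (D.curve e) := by
      rw [hs e]
      exact openSegment_subset_segment _ _ _ hp
    refine D.mem_edgeInterior e hpr ?_ ?_
    · rintro rfl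
      exact D.pos_ne e (left_mem_openSegment_iff.1 hp)
    · rintro rfl
      exact D.pos_ne e (right_mem_openSegment_iff.1 hp)

theorem crosses_iff_orient (D : Drawing G) (hs : D.IsStraightLine)
    (hinj : ∀ {u v : V} (e : G.Adj u v), Function.Injective (D.curve e)) {c : ℂ} {r : ℝ}
    (hc : D.IsOnCircle c r) {u v x y : V} (e : G.Adj u v) (f : G.Adj x y) :
    D.Crosses e f ↔ orient (D.pos u) (D.pos v) (D.pos x) *
      orient (D.pos u) (D.pos v) (D.pos y) < 0 := by
  rw [← openSegment_inter_iff (hc u) (hc v) (hc x) (hc y) (D.pos_ne e) (D.pos_ne f), Crosses,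
    D.edgeInterior_eq_openSegment hs e (hinj e), D.edgeInterior_eq_openSegment hs f (hinj f)]
  have : s(D.pos u, D.pos v) = s(D.pos x, D.pos y) ↔ s(u, v) = s(x, y) := by
    simp only [Sym2.eq_iff, D.pos_injective.eq_iff]
  rw [ne_eq, ne_eq, this]

/-- The straight-line drawing with given positions of the vertices. -/
noncomputable def straightLine (G : SimpleGraph V) (p : V → ℂ) (hp : Function.Injective p) :
    Drawing G where
  pos := p
  pos_injective := hp
  curve {u v} _ := Path.segment (p u) (p v)
  curve_symm _ := (Path.segment_symm _ _).symm

theorem isStraightLine_straightLine (p : V → ℂ) (hp : Function.Injective p) :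
    (straightLine G p hp).IsStraightLine :=
  fun _ => Path.range_segment _ _

theorem straightLine_curve_injective (p : V → ℂ) (hp : Function.Injective p) {u v : V}
    (e : G.Adj u v) : Function.Injective ((straightLine G p hp).curve e) := by
  intro s t hst
  exact Subtype.ext (AffineMap.lineMap_injective ℝ (hp.ne e.ne) hst)

theorem orient_straightLine_curve (p : V → ℂ) (hp : Function.Injective p) (a b : ℂ) {x y : V}
    (f : G.Adj x y) (t : unitInterval) :
    orient a b ((straightLine G p hp).curve f t) =
      (1 - t) * orient a b (p x) + t * orient a b (p y) :=
  orient_lineMap _ _ _ _ _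

theorem orient_eq_zero_of_mem_edgeInterior (p : V → ℂ) (hp : Function.Injective p) {u v : V}
    (e : G.Adj u v) {q : ℂ} (hq : q ∈ (straightLine G p hp).edgeInterior e) :
    orient (p u) (p v) q = 0 := by
  obtain ⟨t, -, rfl⟩ := hq
  rw [orient_straightLine_curve]
  simp only [orient]
  ring

theorem straightLine_crosses_iff {p : V → ℂ} (hp : Function.Injective p) {c : ℂ} {r : ℝ}
    (hc : ∀ v, p v ∈ Metric.sphere c r) {u v x y : V} (e : G.Adj u v) (f : G.Adj x y) :
    (straightLine G p hp).Crosses e f ↔ orient (p u) (p v) (p x) * orient (p u) (p v) (p y) < 0 :=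
  crosses_iff_orient _ (isStraightLine_straightLine p hp) (straightLine_curve_injective p hp) hc e f

/-- The edge from `x` enters the edge `uv` from the side of `x`. -/
theorem passesDownward_straightLine {p : V → ℂ} (hp : Function.Injective p) {c : ℂ} {r : ℝ}
    (hc : ∀ v, p v ∈ Metric.sphere c r)
    {u v x y : V} (e : G.Adj u v) (f : G.Adj x y)
    {h : ℂ ≃ₜ ℂ}
    (hh : ∀ z, (0 < (h z).im ↔ 0 < orient (p u) (p v) (p x) * orient (p u) (p v) z) ∧
      ((h z).im < 0 ↔ orient (p u) (p v) (p x) * orient (p u) (p v) z < 0))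
    (hne : s(u, v) ≠ s(x, y)) {t : unitInterval} (ht : t ∈ Ioo 0 1)
    (hte : (straightLine G p hp).curve f t ∈ (straightLine G p hp).edgeInterior e) :
    PassesDownward h ((straightLine G p hp).curve f) t := by
  have hcr : (straightLine G p hp).Crosses e f := ⟨hne, _, hte, t, ht, rfl⟩
  rw [straightLine_crosses_iff hp hc] at hcr
  have h0 := orient_eq_zero_of_mem_edgeInterior p hp e hte
  rw [orient_straightLine_curve] at h0
  have hpos : 0 < orient (p u) (p v) (p x) ^ 2 -
      orient (p u) (p v) (p x) * orient (p u) (p v) (p y) := by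
    linarith [sq_nonneg (orient (p u) (p v) (p x))]
  have hval : ∀ s : unitInterval, orient (p u) (p v) (p x) *
      orient (p u) (p v) ((straightLine G p hp).curve f s) =
      ((t : ℝ) - s) * (orient (p u) (p v) (p x) ^ 2 -
        orient (p u) (p v) (p x) * orient (p u) (p v) (p y)) := by
    intro s
    rw [orient_straightLine_curve]
    linear_combination orient (p u) (p v) (p x) * h0
  constructor
  · filter_upwards [self_mem_nhdsWithin] with s hs
    rw [(hh _).1, hval]
    exact mul_pos (sub_pos.2 hs) hpos
  · filter_upwards [self_mem_nhdsWithin] with s hs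
    rw [(hh _).2, hval]
    exact mul_neg_of_neg_of_pos (sub_neg.2 hs) hpos

theorem isSimple_straightLine {p : V → ℂ} (hp : Function.Injective p) {c : ℂ} {r : ℝ}
    (hc : ∀ v, p v ∈ Metric.sphere c r) :
    (straightLine G p hp).IsSimple where
  curve_injective e := straightLine_curve_injective p hp e
  vertex_notMem {u v} e w := by
    rintro ⟨t, ht, htw⟩
    have h1 := normSq_lineMap_sub (hc u) (hc v) (t : ℝ)
    have h2 : AffineMap.lineMap (p u) (p v) (t : ℝ) = p w := htw
    rw [h2, Complex.normSq_eq_norm_sq, mem_sphere_iff_norm.1 (hc w)] at h1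
    have h3 : 0 < Complex.normSq (p v - p u) :=
      Complex.normSq_pos.2 (sub_ne_zero.2 (hp.ne e.ne.symm))
    have h4 : (0 : ℝ) < t := ht.1
    have h5 : (t : ℝ) < 1 := ht.2
    have := mul_pos (mul_pos h4 (sub_pos.2 h5)) h3
    linarith
  not_crosses_of_incident {u v w} e f h := by
    rw [straightLine_crosses_iff hp hc] at h
    simp [orient] at h
  crosses_once {u v x y} e f hne := by
    rintro q ⟨hq, s, hs, rfl⟩ q' ⟨hq', s', hs', rfl⟩
    have hcr : (straightLine G p hp).Crosses e f := ⟨hne, _, hq, s, hs, rfl⟩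
    rw [straightLine_crosses_iff hp hc] at hcr
    have h1 := orient_eq_zero_of_mem_edgeInterior p hp e hq
    have h2 := orient_eq_zero_of_mem_edgeInterior p hp e hq'
    rw [orient_straightLine_curve] at h1 h2
    have h3 : ((s : ℝ) - s') * (orient (p u) (p v) (p x) - orient (p u) (p v) (p y)) = 0 := by
      linear_combination h2 - h1
    have h4 : orient (p u) (p v) (p x) - orient (p u) (p v) (p y) ≠ 0 := by
      intro h0
      rw [sub_eq_zero.1 h0] at hcr
      exact absurd hcr (mul_self_nonneg _).not_gt
    have h5 : s = s' := Subtype.ext (sub_eq_zero.1 ((mul_eq_zero.1 h3).resolve_right h4))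
    rw [h5]
  not_tangent {u v x y} e f hne t ht hte := by
    have hcr : (straightLine G p hp).Crosses e f := ⟨hne, _, hte, t, ht, rfl⟩
    rw [straightLine_crosses_iff hp hc] at hcr
    obtain ⟨h, h1, h2⟩ := exists_isStraightening_of_range_eq_segment (hp.ne e.ne)
      ((straightLine G p hp).curve e) (isStraightLine_straightLine p hp e)
      (left_ne_zero_of_mul hcr.ne)
    exact ⟨h, h1, passesDownward_straightLine hp hc e f h2 hne ht hte⟩

/-- For a straight-line drawing on a circle to be outer-fan-planar it suffices that the edges
crossing a given edge have a common vertex: they all leave this vertex on the same side. -/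
theorem isOuterFanPlanar_straightLine {p : V → ℂ} (hp : Function.Injective p) {c : ℂ} {r : ℝ}
    (hc : ∀ v, p v ∈ Metric.sphere c r) (hr : 0 < r)
    (hfan : ∀ {u v : V} (e : G.Adj u v), ∃ z, ∀ {x y : V} (f : G.Adj x y),
      (straightLine G p hp).Crosses e f → ∃ (w : V) (_ : G.Adj z w), s(z, w) = s(x, y)) :
    (straightLine G p hp).IsOuterFanPlanar where
  toIsSimple := isSimple_straightLine hp hc
  fan {u v} e := by
    obtain ⟨z, hz⟩ := hfan e
    have hstraight := fun {z₀} => exists_isStraightening_of_range_eq_segment (hp.ne e.ne)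
      ((straightLine G p hp).curve e) (isStraightLine_straightLine p hp e) (z₀ := z₀)
    have hcr' : ∀ {x y w : V} (f : G.Adj x y) (f' : G.Adj z w), s(z, w) = s(x, y) →
        (straightLine G p hp).Crosses e f → (straightLine G p hp).Crosses e f' := by
      intro x y w f f' hff' hef
      rwa [Crosses, hff', edgeInterior_eq_of_sym2_eq _ f' f hff']
    by_cases hz0 : orient (p u) (p v) (p z) = 0
    · -- then no edge crosses `e`
      obtain ⟨z₀, hz₀⟩ := exists_orient_ne_zero (hp.ne e.ne)
      obtain ⟨h, h1, -⟩ := hstraight hz₀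
      refine ⟨z, h, h1, fun {x y} f hef => ?_⟩
      obtain ⟨w, f', hff'⟩ := hz f hef
      have := (straightLine_crosses_iff hp hc e f').1 (hcr' f f' hff' hef)
      simp [hz0] at this
    · obtain ⟨h, h1, h2⟩ := hstraight hz0
      refine ⟨z, h, h1, fun {x y} f hef => ?_⟩
      obtain ⟨w, f', hff'⟩ := hz f hef
      exact ⟨w, f', hff', fun t ht hte => passesDownward_straightLine hp hc e f' h2
        (hff' ▸ hef.1) ht hte⟩
  mem_outerFace v := by
    have hsupp : (straightLine G p hp).support ⊆ Metric.closedBall c r := by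
      rintro z (⟨w, rfl⟩ | ⟨x, y, f, hz⟩)
      · exact Metric.sphere_subset_closedBall (hc w)
      · rw [isStraightLine_straightLine p hp f] at hz
        exact (convex_closedBall c r).segment_subset (Metric.sphere_subset_closedBall (hc x))
          (Metric.sphere_subset_closedBall (hc y)) hz
    refine ⟨closure_mono (compl_closedBall_subset_outerFace _ hr.le hsupp) ?_, fun h => ?_⟩
    · rw [closure_compl, interior_closedBall c hr.ne']
      intro h
      exact (Metric.mem_ball.1 h).ne (hc v)
    · exact (interior_subset h).1 (pos_mem_support _ v)

end Drawing

/-! ### Crossings and cyclic orders -/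

namespace Drawing

variable {V : Type*} {G : SimpleGraph V}

/-- A drawing with all vertices on the outer face can be replaced by a straight-line drawing on
any circle in which an edge pair crosses only if it crossed before, so that fans remain fans. -/
theorem IsOuterFanPlanar.exists_straightLine [Finite V] {D : Drawing G} (hD : D.IsOuterFanPlanar)
    (c : ℂ) {r : ℝ} (hr : 0 < r) :
    ∃ D' : Drawing G, D'.IsOuterFanPlanar ∧ D'.IsStraightLine ∧ D'.IsOnCircle c r := by
  obtain ⟨R, hR, q, hq, hqR, hcross⟩ := D.exists_circle_model hD.vertex_notMem hD.mem_outerFace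
  let p : V → ℂ := fun v => c + (r / R : ℝ) * q v
  have hrR : 0 < r / R := div_pos hr hR
  have hp : Function.Injective p := by
    intro u v huv
    apply hq
    have h1 := add_left_cancel huv
    exact mul_left_cancel₀ (by exact_mod_cast hrR.ne') h1
  have hpc : ∀ v, p v ∈ Metric.sphere c r := by
    intro v
    rw [mem_sphere_iff_norm, add_sub_cancel_left, norm_mul, mem_sphere_zero_iff_norm.1 (hqR v),
      Complex.norm_real, Real.norm_of_nonneg hrR.le, div_mul_cancel₀ _ hR.ne']
  have horient : ∀ u v w, orient (p u) (p v) (p w) = (r / R) ^ 2 * orient (q u) (q v) (q w) := by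
    intro u v w
    simp only [p, orient, Complex.add_re, Complex.add_im, Complex.re_ofReal_mul,
      Complex.im_ofReal_mul]
    ring
  refine ⟨straightLine G p hp, isOuterFanPlanar_straightLine hp hpc hr fun {u v} e => ?_,
    isStraightLine_straightLine p hp, hpc⟩
  obtain ⟨z, _, _, hz⟩ := hD.fan e
  refine ⟨z, fun {x y} f hef => ?_⟩
  rw [straightLine_crosses_iff hp hpc, horient, horient, mul_mul_mul_comm] at hef
  obtain ⟨w, f', hff', -⟩ := hz f (hcross e f (neg_of_mul_neg_right hef (by positivity)))
  exact ⟨w, f', hff'⟩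

theorem cyclicOrder_iff_orient {D : Drawing G} {c : ℂ} {r : ℝ} (hr : 0 < r)
    (hc : D.IsOnCircle c r) (u v w : V) :
    D.CyclicOrder c u v w ↔ 0 < orient (D.pos u) (D.pos v) (D.pos w) :=
  sbtw_arg_iff_orient_pos hr (hc u) (hc v) (hc w)

theorem crosses_iff_cyclicOrder {D : Drawing G} (hD : D.IsSimple) (hs : D.IsStraightLine) {c : ℂ}
    {r : ℝ} (hr : 0 < r) (hc : D.IsOnCircle c r) {u v x y : V} (e : G.Adj u v) (f : G.Adj x y) :
    D.Crosses e f ↔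
      (D.CyclicOrder c u x v ∧ D.CyclicOrder c v y u) ∨
      (D.CyclicOrder c u y v ∧ D.CyclicOrder c v x u) := by
  simp only [cyclicOrder_iff_orient hr hc]
  rw [D.crosses_iff_orient hs hD.curve_injective hc, orient_swap (D.pos u) (D.pos v),
    orient_swap (D.pos u) (D.pos v), orient_rotate (D.pos u) (D.pos v),
    orient_rotate (D.pos u) (D.pos v), neg_pos, neg_pos, mul_neg_iff]
  tauto

/-- Along an edge `uv`, two crossing edges `zw` and `zw'` come in the order in which they leave
`z`. -/
theorem crossesBefore_iff_orient {D : Drawing G} (hD : D.IsSimple) (hs : D.IsStraightLine) {c : ℂ}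
    {r : ℝ} (hc : D.IsOnCircle c r) {u v z w w' : V} (e : G.Adj u v) (f : G.Adj z w)
    (g : G.Adj z w') :
    D.CrossesBefore e f g ↔ D.Crosses e f ∧ D.Crosses e g ∧
      0 < orient (D.pos z) (D.pos u) (D.pos v) * orient (D.pos z) (D.pos w) (D.pos w') := by
  obtain ⟨l, hl, hel⟩ := (D.curve e).exists_strictMono_of_range_subset_segment (D.pos_ne e)
    (hD.curve_injective e) (hs e).subset
  have hz : D.Crosses e f → orient (D.pos z) (D.pos u) (D.pos v) ≠ 0 := by
    intro h
    rw [D.crosses_iff_orient hs hD.curve_injective hc] at h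
    rw [← orient_rotate]
    exact left_ne_zero_of_mul h.ne
  have key : D.Crosses e f → ∀ s t : unitInterval,
      D.curve e s ∈ D.edgeInterior f → D.curve e t ∈ D.edgeInterior g →
      (s < t ↔
        0 < orient (D.pos z) (D.pos u) (D.pos v) * orient (D.pos z) (D.pos w) (D.pos w')) := by
    intro hef s t hsf htg
    rw [D.edgeInterior_eq_openSegment hs f (hD.curve_injective f)] at hsf
    rw [D.edgeInterior_eq_openSegment hs g (hD.curve_injective g)] at htg
    obtain ⟨a, ha, hsa⟩ := exists_lineMap_of_mem_openSegment hsf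
    obtain ⟨b, hb, htb⟩ := exists_lineMap_of_mem_openSegment htg
    -- the area of the triangle formed by `z` and the two crossings, computed in two ways
    have h1 : orient (D.pos z) (D.curve e s) (D.curve e t) =
        (l t - l s) * orient (D.pos z) (D.pos u) (D.pos v) := by
      rw [hel, hel]
      simp only [orient, lineMap_re, lineMap_im]
      ring
    have h2 : orient (D.pos z) (D.curve e s) (D.curve e t) =
        a * b * orient (D.pos z) (D.pos w) (D.pos w') := by
      rw [hsa, htb]
      simp only [orient, lineMap_re, lineMap_im]
      ring
    have hab : 0 < a * b := mul_pos ha.1 hb.1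
    rw [← hl.lt_iff_lt, ← sub_pos]
    have h3 : (l t - l s) * orient (D.pos z) (D.pos u) (D.pos v) ^ 2 =
        a * b * (orient (D.pos z) (D.pos u) (D.pos v) * orient (D.pos z) (D.pos w) (D.pos w')) := by
      linear_combination orient (D.pos z) (D.pos u) (D.pos v) * (h2 - h1)
    have hsq : 0 < orient (D.pos z) (D.pos u) (D.pos v) ^ 2 := by
      have := hz hef
      positivity
    rw [← mul_pos_iff_of_pos_right hsq, h3, mul_pos_iff_of_pos_left hab]
  constructor
  · rintro ⟨hf, hg, s, -, t, -, hst, hsf, htg⟩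
    exact ⟨hf, hg, (key hf s t hsf htg).1 hst⟩
  · rintro ⟨hf, hg, h⟩
    obtain ⟨-, -, ⟨s, hs, rfl⟩, hsf⟩ := id hf
    obtain ⟨-, -, ⟨t, ht, rfl⟩, htg⟩ := id hg
    exact ⟨hf, hg, s, hs, t, ht, (key hf s t hsf htg).2 h, hsf, htg⟩

theorem crosses_congr (D : Drawing G) {u v x y x' y' : V} (e : G.Adj u v) {f : G.Adj x y}
    {f' : G.Adj x' y'} (h : s(x, y) = s(x', y')) : D.Crosses e f ↔ D.Crosses e f' := by
  rw [Crosses, Crosses, h, D.edgeInterior_eq_of_sym2_eq f f' h]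

theorem crossesBefore_congr (D : Drawing G) {u v x y x' y' a b a' b' : V} (e : G.Adj u v)
    {f : G.Adj x y} {f' : G.Adj x' y'} {g : G.Adj a b} {g' : G.Adj a' b'}
    (hf : s(x, y) = s(x', y')) (hg : s(a, b) = s(a', b')) :
    D.CrossesBefore e f g ↔ D.CrossesBefore e f' g' := by
  rw [CrossesBefore, CrossesBefore, D.crosses_congr e (f' := f') hf,
    D.crosses_congr e (f' := g') hg, D.edgeInterior_eq_of_sym2_eq f f' hf,
    D.edgeInterior_eq_of_sym2_eq g g' hg]

/-- In a straight-line outer-fan-planar drawing on a circle, the order of the crossings along an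
edge `uv` depends on the cyclic order of the vertices only: two edges crossing `uv` have a common
vertex `z`, and the order of their crossings is that in which they leave `z`. -/
theorem CrossesBefore.of_cyclicOrder {D D' : Drawing G} (hD : D.IsOuterFanPlanar)
    (hD' : D'.IsSimple) (hs : D.IsStraightLine) (hs' : D'.IsStraightLine) {c c' : ℂ} {r r' : ℝ}
    (hr : 0 < r) (hr' : 0 < r') (hc : D.IsOnCircle c r) (hc' : D'.IsOnCircle c' r')
    (hcyc : ∀ u v w : V, D.CyclicOrder c u v w ↔ D'.CyclicOrder c' u v w)
    {u v x y x' y' : V} {e : G.Adj u v} {f : G.Adj x y} {g : G.Adj x' y'}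
    (h : D.CrossesBefore e f g) : D'.CrossesBefore e f g := by
  have hpos : ∀ u v w, 0 < orient (D.pos u) (D.pos v) (D.pos w) ↔
      0 < orient (D'.pos u) (D'.pos v) (D'.pos w) := by
    intro u v w
    rw [← cyclicOrder_iff_orient hr hc, ← cyclicOrder_iff_orient hr' hc', hcyc]
  have hneg : ∀ u v w, orient (D.pos u) (D.pos v) (D.pos w) < 0 ↔
      orient (D'.pos u) (D'.pos v) (D'.pos w) < 0 := by
    intro u v w
    rw [← neg_pos, ← neg_pos, ← orient_swap, ← orient_swap, hpos]
  have hcr : ∀ {x y : V} (f : G.Adj x y), D.Crosses e f → D'.Crosses e f := by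
    intro x y f
    rw [crosses_iff_cyclicOrder hD.toIsSimple hs hr hc,
      crosses_iff_cyclicOrder hD' hs' hr' hc']
    simp only [hcyc, imp_self]
  obtain ⟨z, _, _, hz⟩ := hD.fan e
  obtain ⟨w, f', hf', -⟩ := hz f h.1
  obtain ⟨w', g', hg', -⟩ := hz g h.2.1
  rw [← crossesBefore_congr _ e (f := f') (g := g') hf' hg'] at h ⊢
  rw [crossesBefore_iff_orient hD.toIsSimple hs hc] at h
  rw [crossesBefore_iff_orient hD' hs' hc']
  refine ⟨hcr f' h.1, hcr g' h.2.1, ?_⟩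
  simpa only [mul_pos_iff, hpos, hneg] using h.2.2

end Drawing

theorem mainTheorem4 {V : Type*} [Finite V] (G : SimpleGraph V) (hG : G.IsBiconnected) :
    -- outer-fan-planarity is equivalent to the existence of a drawing on any prescribed circle
    (∀ (c : ℂ) (r : ℝ), 0 < r →
      (G.IsOuterFanPlanar ↔
        ∃ D : Drawing G, D.IsOuterFanPlanar ∧ D.IsStraightLine ∧ D.IsOnCircle c r)) ∧
    -- in such a drawing two edges cross iff their end-points alternate in the cyclic order
    (∀ (c : ℂ) (r : ℝ) (D : Drawing G), 0 < r →
      D.IsOuterFanPlanar → D.IsStraightLine → D.IsOnCircle c r →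
      ∀ {u v x y : V} (e : G.Adj u v) (f : G.Adj x y),
        D.Crosses e f ↔
          (D.CyclicOrder c u x v ∧ D.CyclicOrder c v y u) ∨
          (D.CyclicOrder c u y v ∧ D.CyclicOrder c v x u)) ∧
    -- two such drawings with the same cyclic order have the same crossings, in the same order
    (∀ (c c' : ℂ) (r r' : ℝ) (D D' : Drawing G), 0 < r → 0 < r' →
      D.IsOuterFanPlanar → D.IsStraightLine → D.IsOnCircle c r →
      D'.IsOuterFanPlanar → D'.IsStraightLine → D'.IsOnCircle c' r' →
      (∀ u v w : V, D.CyclicOrder c u v w ↔ D'.CyclicOrder c' u v w) →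
      (∀ {u v x y : V} (e : G.Adj u v) (f : G.Adj x y), D.Crosses e f ↔ D'.Crosses e f) ∧
      (∀ {u v x y x' y' : V} (e : G.Adj u v) (f : G.Adj x y) (g : G.Adj x' y'),
        D.CrossesBefore e f g ↔ D'.CrossesBefore e f g)) := by
  refine ⟨fun c r hr => ⟨fun ⟨D, hD⟩ => hD.exists_straightLine c hr, fun ⟨D, hD, _⟩ => ⟨D, hD⟩⟩,
    fun c r D hr hD hs hc u v x y e f => Drawing.crosses_iff_cyclicOrder hD.toIsSimple hs hr hc e f,
    fun c c' r r' D D' hr hr' hD hs hc hD' hs' hc' hcyc => ⟨fun e f => ?_, fun e f g => ⟨?_, ?_⟩⟩⟩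
  · rw [Drawing.crosses_iff_cyclicOrder hD.toIsSimple hs hr hc,
      Drawing.crosses_iff_cyclicOrder hD'.toIsSimple hs' hr' hc']
    simp only [hcyc]
  · exact Drawing.CrossesBefore.of_cyclicOrder hD hD'.toIsSimple hs hs' hr hr' hc hc' hcyc
  · exact Drawing.CrossesBefore.of_cyclicOrder hD' hD.toIsSimple hs' hs hr' hr hc' hc
      fun u v w => (hcyc u v w).symm
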